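/- Let $K$ be a field, let $G$ be a finite group whose order is not divisible by the characteristic of $K$, and let $V$ be a finite-dimensional representation of $G$ over $K$. Let $K[V]=\operatorname{Sym}(V^*)$ be the coordinate ring of $V$, with its standard grading and the induced action of $G$, and let $I\subseteq K[V]$ be the ideal generated by all homogeneous invariants of positive degree. Let $\tau_G(V)$ be the smallest integer $d\ge 0$ such that every homogeneous polynomial of degree $d$ in $K[V]$ lies in $I$ (such a $d$ exists). Suppose that $\{f_1,\dots,f_r\}$ is a minimal set of homogeneous generators of the $K$-algebra $K[V]^G$, with $f_i$ of degree $d_i$. Let $$J=\{h\in K[x_1,\dots,x_r] \mid h(f_1,\dots,f_r)=0\}$$ be the ideal of relations, where $K[x_1,\dots,x_r]$ is graded by $\deg(x_i)=d_i$. Then the ideal $J$ is generated by homogeneous elements of degree at most $2\tau_G(V)$, and $2\tau_G(V)\le 2|G|$. -/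

import Mathlib

noncomputable section

namespace InvariantSyzygies

variable (K : Type*) [Field K] (V : Type*) [AddCommGroup V] [Module K V]

/-- The coordinate ring `K[V]`: the symmetric algebra of the dual space of `V`, that is, a
polynomial ring over `K` in `dim V` variables when `V` is finite dimensional. -/
abbrev CoordRing : Type _ := SymmetricAlgebra K (Module.Dual K V)

/-- The space of homogeneous polynomials of degree `d` in `K[V]`: the span of the `d`-fold
products of linear forms. -/
def homogeneousPart (d : ℕ) : Submodule K (CoordRing K V) :=
  LinearMap.range (SymmetricAlgebra.ι K (Module.Dual K V)) ^ d

variable {K V} {G : Type*} [Group G] (ρ : Representation K G V)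

/-- The action of `g` on `K[V]`: the algebra endomorphism that sends a linear form `l` to
`l ∘ g⁻¹`. -/
def act (g : G) : CoordRing K V →ₐ[K] CoordRing K V :=
  SymmetricAlgebra.lift (SymmetricAlgebra.ι K (Module.Dual K V) ∘ₗ ρ.dual g)

/-- The ring of invariants `K[V]^G`. -/
def invariantRing : Subalgebra K (CoordRing K V) :=
  ⨅ g : G, AlgHom.equalizer (act ρ g) (AlgHom.id K (CoordRing K V))

/-- The Hilbert ideal: the ideal of `K[V]` generated by all homogeneous invariants of positive
degree. -/
def hilbertIdeal : Ideal (CoordRing K V) :=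
  Ideal.span {p | p ∈ invariantRing ρ ∧ ∃ d : ℕ, 0 < d ∧ p ∈ homogeneousPart K V d}

/-- The degrees `d` such that every homogeneous polynomial of degree `d` lies in the Hilbert
ideal. -/
def hilbertDegrees : Set ℕ :=
  {d | ∀ p ∈ homogeneousPart K V d, p ∈ hilbertIdeal ρ}

/-- `τ_G(V)`, the least element of `hilbertDegrees ρ`. -/
def tau : ℕ := sInf (hilbertDegrees ρ)

/-- The family `f` is a minimal generating set of the invariant ring: it generates the ring as a
`K`-algebra, and no proper subfamily does. -/
def IsMinimalGenerators {r : ℕ} (f : Fin r → CoordRing K V) : Prop :=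
  Algebra.adjoin K (Set.range f) = invariantRing ρ ∧
    ∀ s : Set (Fin r), Algebra.adjoin K (f '' s) = invariantRing ρ → s = Set.univ

/-- The ideal of relations (syzygy ideal) `{h ∈ K[x₁, …, xᵣ] | h(f₁, …, fᵣ) = 0}`. -/
def relationIdeal {r : ℕ} (f : Fin r → CoordRing K V) : Ideal (MvPolynomial (Fin r) K) :=
  RingHom.ker (MvPolynomial.aeval f : MvPolynomial (Fin r) K →ₐ[K] CoordRing K V)

/-- In the polynomial ring graded by `deg xᵢ = d i`, the ideal `J` is generated by its homogeneous
elements of degree at most `D`. -/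
def GeneratedInDegreeLE {r : ℕ} (d : Fin r → ℕ) (J : Ideal (MvPolynomial (Fin r) K)) (D : ℕ) :
    Prop :=
  Ideal.span {h | h ∈ J ∧ ∃ e : ℕ, e ≤ D ∧ MvPolynomial.IsWeightedHomogeneous d h e} = J

end InvariantSyzygies

end

/-! Write `S = K[V]`, `m` for its ideal of positive-degree elements, `τ` for `τ_G(V)`. The `fᵢ`
generate the Hilbert ideal `I`, so `m ^ τ ≤ I`. Since `S/I` vanishes in degrees at least `τ`,
exactness of the Koszul complex of the variables shows that a syzygy of the `fᵢ` over `S` of degree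
`τ + 1 + j` lies in `m ^ j • Syz` (`mem_idealOfVars_pow_smul_syzygies`). Above degree `2τ` the power
is at least `τ`, so the syzygy lies in `I • Syz`. As `I` annihilates Koszul homology, it is a Koszul
syzygy (`mem_koszulBoundary_of_isHomogeneous`).

Let `h = ∑ xᵢ cᵢ` be a relation of degree above `2τ`. Then `(cᵢ(f))` is a syzygy, hence Koszul. The
Reynolds operator makes its Koszul coefficients invariant, so they lift to `K[x]`. Subtracting the
lifted Koszul syzygy from `(cᵢ)` leaves the sum `∑ xᵢ cᵢ` unchanged and turns each `cᵢ` into a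
relation of smaller degree (`exists_relations_sum_X_mul`). Induction on the degree finishes.

The bound `τ ≤ |G|` is Benson's lemma (`prod_mem_hilbertIdeal`). -/

namespace InvariantSyzygies

/-! ### Koszul relations over a commutative ring -/

section Koszul

variable {A ι : Type*} [CommRing A] [Fintype ι]

/-- The submodule of trivial (Koszul) relations on a family `x`. -/
def koszulBoundary (x : ι → A) : Submodule A (ι → A) where
  carrier := {a | ∃ u : ι → ι → A, ∀ i, a i = ∑ j, x j * (u i j - u j i)}
  add_mem' := by
    rintro a b ⟨u, hu⟩ ⟨v, hv⟩
    refine ⟨u + v, fun i => ?_⟩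
    rw [Pi.add_apply, hu, hv, ← Finset.sum_add_distrib]
    exact Finset.sum_congr rfl fun j _ => by simp only [Pi.add_apply]; ring
  zero_mem' := ⟨0, fun i => by simp⟩
  smul_mem' := by
    rintro c a ⟨u, hu⟩
    refine ⟨c • u, fun i => ?_⟩
    rw [Pi.smul_apply, hu, smul_eq_mul, Finset.mul_sum]
    exact Finset.sum_congr rfl fun j _ => by simp only [Pi.smul_apply, smul_eq_mul]; ring

/-- The module of relations on a family `x`. -/
def syzygies (x : ι → A) : Submodule A (ι → A) where
  carrier := {a | ∑ i, x i * a i = 0}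
  add_mem' := by
    intro a b ha hb
    simp only [Set.mem_ofPred_eq, Pi.add_apply, mul_add, Finset.sum_add_distrib] at *
    rw [ha, hb, add_zero]
  zero_mem' := by simp
  smul_mem' := by
    intro c a ha
    simp only [Set.mem_ofPred_eq, Pi.smul_apply, smul_eq_mul, mul_left_comm _ c,
      ← Finset.mul_sum] at *
    rw [ha, mul_zero]

theorem mem_syzygies {x a : ι → A} : a ∈ syzygies x ↔ ∑ i, x i * a i = 0 := Iff.rfl

theorem sum_mul_sum_antisymm_eq_zero (x : ι → A) (u : ι → ι → A) :
    ∑ i, x i * ∑ j, x j * (u i j - u j i) = 0 := by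
  have h : ∑ i, ∑ j, x i * (x j * u i j) = ∑ i, ∑ j, x i * (x j * u j i) := by
    rw [Finset.sum_comm]
    exact Finset.sum_congr rfl fun i _ => Finset.sum_congr rfl fun j _ => by ring
  simp only [Finset.mul_sum, mul_sub, Finset.sum_sub_distrib]
  rw [h, sub_self]

/-- The ideal of the `x k` annihilates first Koszul homology. For a syzygy `z`, the multiple `x k •
z` is the boundary of the array whose column `k` is `z`: the transposed term contributes `∑ x j * z
j = 0` in row `k` and nothing elsewhere. -/
theorem span_smul_syzygies_le_koszulBoundary (x : ι → A) :
    Ideal.span (Set.range x) • syzygies x ≤ koszulBoundary x := by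
  classical
  refine Submodule.smul_le.2 fun r hr z hz => ?_
  induction hr using Submodule.span_induction with
  | zero => rw [zero_smul]; exact zero_mem _
  | add a b _ _ ha hb => rw [add_smul]; exact add_mem ha hb
  | smul c a _ ha => rw [smul_assoc]; exact Submodule.smul_mem _ c ha
  | mem a ha =>
    obtain ⟨k, rfl⟩ := ha
    refine ⟨fun i j => if j = k then z i else 0, fun i => ?_⟩
    simp only [mul_sub, Finset.sum_sub_distrib, mul_ite, mul_zero, Finset.sum_ite_eq',
      Finset.mem_univ, if_true, Pi.smul_apply, smul_eq_mul]
    split_ifs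
    · rw [mem_syzygies.1 hz, sub_zero]
    · simp

end Koszul

/-! ### Koszul exactness for the variables -/

section Variables

open MvPolynomial

variable {K : Type*} [Field K] {σ : Type*}

/-- Variables form a regular sequence. Membership in an ideal of variables is tested monomial by
monomial, and the factor `X j` supplies no variable from `s`. -/
theorem mem_span_X_image_of_X_mul_mem {s : Set σ} {j : σ} (hj : j ∉ s) {b : MvPolynomial σ K}
    (h : X j * b ∈ Ideal.span (X '' s : Set (MvPolynomial σ K))) :
    b ∈ Ideal.span (X '' s : Set (MvPolynomial σ K)) := by
  classical
  rw [mem_ideal_span_X_image] at h ⊢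
  intro m hm
  obtain ⟨i, hi, hne⟩ := h (Finsupp.single j 1 + m) (by
    rw [mem_support_iff, coeff_X_mul]
    exact mem_support_iff.1 hm)
  refine ⟨i, hi, ?_⟩
  have hij : j ≠ i := fun h => hj (h ▸ hi)
  simpa [Finsupp.single_apply, hij] using hne

theorem exists_antisymm_of_sum_X_mul_eq_zero (s : Finset σ) :
    ∀ b : σ → MvPolynomial σ K, ∑ k ∈ s, X k * b k = 0 →
      ∃ t : σ → σ → MvPolynomial σ K, ∀ k ∈ s, b k = ∑ l ∈ s, X l * (t k l - t l k) := by
  classical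
  induction s using Finset.induction_on with
  | empty => exact fun b _ => ⟨0, by simp⟩
  | insert j s hj ih =>
    intro b hb
    rw [Finset.sum_insert hj] at hb
    have hmem : b j ∈ Ideal.span (X '' (s : Set σ) : Set (MvPolynomial σ K)) := by
      refine mem_span_X_image_of_X_mul_mem (by simpa using hj) ?_
      rw [eq_neg_of_add_eq_zero_left hb]
      exact neg_mem (sum_mem fun k hk => Ideal.mul_mem_right _ _
        (Ideal.subset_span ⟨k, hk, rfl⟩))
    -- Regularity gives `b j = ∑ c l * X l` over `s`. Substituting this leaves a relation among the
    -- variables in `s` alone, with coefficients `b k + X j * c k`.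
    obtain ⟨c, hc⟩ := (Submodule.mem_span_image_finset_iff_exists_fun' _).1 hmem
    obtain ⟨t, ht⟩ := ih (fun k => b k + X j * c k) (by
      simp only [mul_add, Finset.sum_add_distrib]
      rw [← hb, add_comm, ← hc, Finset.mul_sum]
      congr 1
      exact Finset.sum_congr rfl fun k _ => by rw [smul_eq_mul]; ring)
    -- Row `j` holds `c`, column `j` is zero, and the remaining entries come from the induction
    -- hypothesis.
    refine ⟨fun k l => if k = j then (if l = j then 0 else c l) else
      if l = j then 0 else t k l, fun k hk => ?_⟩
    rw [Finset.sum_insert hj]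
    rcases Finset.mem_insert.1 hk with rfl | hk
    · rw [← hc]
      simp only [if_true, sub_self, mul_zero, zero_add]
      refine Finset.sum_congr rfl fun l hl => ?_
      have hlk : l ≠ k := fun h => hj (h ▸ hl)
      simp only [hlk, if_false, sub_zero, smul_eq_mul]
      ring
    · have hkj : k ≠ j := fun h => hj (h ▸ hk)
      have hsum : ∑ l ∈ s, X l * (t k l - t l k) = b k + X j * c k := (ht k hk).symm
      simp only [hkj, if_true, if_false]
      rw [Finset.sum_congr rfl (g := fun l => X l * (t k l - t l k)) fun l hl => by
        have hlj : l ≠ j := fun h => hj (h ▸ hl)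
        simp only [hlj, if_false], hsum]
      ring

end Variables

/-! ### Homogeneous coefficients -/

section Graded

open MvPolynomial

variable {K : Type*} [Field K] {σ : Type*} {w : σ → ℕ}

theorem weightedHomogeneousComponent_mul_of_le {a : MvPolynomial σ K} {m : ℕ}
    (ha : IsWeightedHomogeneous w a m) (b : MvPolynomial σ K) {n : ℕ} (h : m ≤ n) :
    weightedHomogeneousComponent w n (a * b) = a * weightedHomogeneousComponent w (n - m) b := by
  let _ := weightedGradedAlgebra K w
  simp only [← weightedDecomposition.decompose'_apply]
  exact DirectSum.coe_decompose_mul_of_left_mem_of_le (weightedHomogeneousSubmodule K w) ha h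

theorem weightedHomogeneousComponent_mul_of_lt {a : MvPolynomial σ K} {m : ℕ}
    (ha : IsWeightedHomogeneous w a m) (b : MvPolynomial σ K) {n : ℕ} (h : n < m) :
    weightedHomogeneousComponent w n (a * b) = 0 := by
  let _ := weightedGradedAlgebra K w
  simp only [← weightedDecomposition.decompose'_apply]
  exact DirectSum.coe_decompose_mul_of_left_mem_of_not_le (weightedHomogeneousSubmodule K w) ha
    h.not_ge

/-- Taking components of any coefficients suffices. The clause for `n < δ i` is needed because `n -
δ i` truncates to `0` there, which would allow a nonzero constant. -/
theorem exists_homogeneous_coeffs {ι : Type*} [Fintype ι] {g : ι → MvPolynomial σ K} {δ : ι → ℕ}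
    (hg : ∀ i, IsWeightedHomogeneous w (g i) (δ i)) {p : MvPolynomial σ K} {n : ℕ}
    (hp : IsWeightedHomogeneous w p n) (hpg : p ∈ Ideal.span (Set.range g)) :
    ∃ c : ι → MvPolynomial σ K, (∀ i, IsWeightedHomogeneous w (c i) (n - δ i)) ∧
      (∀ i, n < δ i → c i = 0) ∧ ∑ i, g i * c i = p := by
  obtain ⟨b, hb⟩ := Ideal.mem_span_range_iff_exists_fun.1 hpg
  refine ⟨fun i => if δ i ≤ n then weightedHomogeneousComponent w (n - δ i) (b i) else 0,
    fun i => ?_, fun i hi => if_neg hi.not_ge, ?_⟩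
  · dsimp only
    split_ifs
    · exact weightedHomogeneousComponent_isWeightedHomogeneous _ _
    · exact isWeightedHomogeneous_zero _ _ _
  · rw [← IsWeightedHomogeneous.weightedHomogeneousComponent_same hp, ← hb, map_sum]
    refine Finset.sum_congr rfl fun i _ => ?_
    dsimp only
    rw [mul_comm (b i)]
    split_ifs with h
    · rw [weightedHomogeneousComponent_mul_of_le (hg i) _ h]
    · rw [weightedHomogeneousComponent_mul_of_lt (hg i) _ (not_le.1 h), mul_zero]

theorem mem_span_range_X {p : MvPolynomial σ K} (h : constantCoeff p = 0) :
    p ∈ Ideal.span (Set.range (X : σ → MvPolynomial σ K)) := by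
  rw [← Set.image_univ, mem_ideal_span_X_image]
  intro m hm
  by_contra! H
  have : m = 0 := Finsupp.ext fun i => H i (Set.mem_univ i)
  exact mem_support_iff.1 hm (this ▸ h)

theorem constantCoeff_eq_zero {p : MvPolynomial σ K} {n : ℕ} (hp : IsWeightedHomogeneous w p n)
    (hn : 0 < n) : constantCoeff p = 0 :=
  hp.coeff_eq_zero 0 (by simpa using hn.ne)

theorem exists_homogeneous_X_coeffs [Fintype σ] {p : MvPolynomial σ K} {n : ℕ}
    (hp : p.IsHomogeneous (n + 1)) :
    ∃ c : σ → MvPolynomial σ K, (∀ k, (c k).IsHomogeneous n) ∧ ∑ k, X k * c k = p := by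
  obtain ⟨c, hc, -, h⟩ := exists_homogeneous_coeffs (w := 1) (g := (X : σ → MvPolynomial σ K))
    (δ := 1) (fun i => isHomogeneous_X K i) hp (mem_span_range_X (constantCoeff_eq_zero hp
    n.succ_pos))
  exact ⟨c, hc, h⟩

theorem exists_homogeneous_antisymm [Fintype σ] {b : σ → MvPolynomial σ K} {n : ℕ}
    (hb : ∀ k, (b k).IsHomogeneous (n + 1)) (h : ∑ k, X k * b k = 0) :
    ∃ t : σ → σ → MvPolynomial σ K, (∀ k l, (t k l).IsHomogeneous n) ∧
      ∀ k, b k = ∑ l, X l * (t k l - t l k) := by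
  obtain ⟨t, ht⟩ := exists_antisymm_of_sum_X_mul_eq_zero Finset.univ b h
  refine ⟨fun k l => homogeneousComponent n (t k l),
    fun k l => homogeneousComponent_isHomogeneous _ _, fun k => ?_⟩
  have h1 : homogeneousComponent (n + 1) (b k) = b k :=
    IsWeightedHomogeneous.weightedHomogeneousComponent_same (hb k)
  rw [← h1, ht k (Finset.mem_univ k), map_sum]
  refine Finset.sum_congr rfl fun l _ => ?_
  rw [← map_sub]
  exact weightedHomogeneousComponent_mul_of_le (isHomogeneous_X K l) _ (Nat.le_add_left 1 n)

end Graded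

end InvariantSyzygies

namespace InvariantSyzygies

open MvPolynomial

/-! ### Syzygies of high degree are Koszul -/

section Syzygies

variable {K : Type*} [Field K] {σ : Type*} {τ : ℕ}

theorem idealOfVars_pow_le {I : Ideal (MvPolynomial σ K)}
    (hI : ∀ p : MvPolynomial σ K, p.IsHomogeneous τ → p ∈ I) : idealOfVars σ K ^ τ ≤ I := by
  rw [pow_idealOfVars_eq_span, Ideal.span_le]
  rintro _ ⟨u, hu, rfl⟩
  exact hI _ (isHomogeneous_monomial 1 hu)

variable [Fintype σ]

theorem mem_of_isHomogeneous_of_le {I : Ideal (MvPolynomial σ K)}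
    (hI : ∀ p : MvPolynomial σ K, p.IsHomogeneous τ → p ∈ I) {n : ℕ} (hn : τ ≤ n) :
    ∀ p : MvPolynomial σ K, p.IsHomogeneous n → p ∈ I := by
  induction n, hn using Nat.le_induction with
  | base => exact hI
  | succ n _ ih =>
    intro p hp
    obtain ⟨c, hc, rfl⟩ := exists_homogeneous_X_coeffs hp
    exact sum_mem fun k _ => Ideal.mul_mem_left _ _ (ih _ (hc k))

variable {ι : Type*} [Fintype ι] {f : ι → MvPolynomial σ K} {d : ι → ℕ}

/-- A homogeneous relation of degree at least `τ + 2` is a combination, with the variables as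
coefficients, of homogeneous relations of degree one less. -/
theorem exists_syzygies_sum_X_mul (hf : ∀ i, (f i).IsHomogeneous (d i)) (hd : ∀ i, d i ≤ τ)
    (hI : ∀ p : MvPolynomial σ K, p.IsHomogeneous τ → p ∈ Ideal.span (Set.range f))
    {e : ℕ} (he : τ ≤ e) {a : ι → MvPolynomial σ K} (ha : a ∈ syzygies f)
    (hah : ∀ i, (a i).IsHomogeneous (e + 2 - d i)) :
    ∃ a' : σ → ι → MvPolynomial σ K, (∀ k, a' k ∈ syzygies f) ∧
      (∀ k i, (a' k i).IsHomogeneous (e + 1 - d i)) ∧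
      a = ∑ k, (X k : MvPolynomial σ K) • a' k := by
  have hde : ∀ i, d i ≤ e := fun i => (hd i).trans he
  have hX : ∀ i, ∃ c : σ → MvPolynomial σ K,
      (∀ k, (c k).IsHomogeneous (e + 1 - d i)) ∧ ∑ k, X k * c k = a i := fun i =>
    exists_homogeneous_X_coeffs (by
      have := hah i
      rwa [show e + 2 - d i = e + 1 - d i + 1 by have := hde i; omega] at this)
  choose c hc hca using hX
  -- The `c · k` need not be syzygies. Their defects `b k` satisfy `∑ X k * b k = 0`, so they form a
  -- Koszul boundary with entries `t k l` of degree `e`.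
  obtain ⟨t, ht, htb⟩ := exists_homogeneous_antisymm (n := e) (b := fun k => ∑ i, f i * c i k)
    (fun k => IsHomogeneous.sum _ _ _ fun i _ => by
      have := (hf i).mul (hc i k)
      rwa [show d i + (e + 1 - d i) = e + 1 by have := hde i; omega] at this)
    (by
      rw [← mem_syzygies.1 ha]
      simp only [Finset.mul_sum, ← hca]
      rw [Finset.sum_comm]
      exact Finset.sum_congr rfl fun i _ => Finset.sum_congr rfl fun k _ => by ring)
  -- As `e ≥ τ`, each `t k l` lies in the ideal of the `f i`. Its coefficients `s` correct `c` to a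
  -- syzygy, and the correction is antisymmetric, so it cancels after multiplying by `X k` and
  -- summing.
  have hT : ∀ k l, ∃ s : ι → MvPolynomial σ K, (∀ i, (s i).IsHomogeneous (e - d i)) ∧
      ∑ i, f i * s i = t k l := fun k l => by
    obtain ⟨s, hs, -, h⟩ := exists_homogeneous_coeffs hf (ht k l)
      (mem_of_isHomogeneous_of_le hI he _ (ht k l))
    exact ⟨s, hs, h⟩
  choose s hs hst using hT
  refine ⟨fun k i => c i k - ∑ l, X l * (s k l i - s l k i), fun k => ?_, fun k i => ?_, ?_⟩
  · rw [mem_syzygies]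
    simp only [mul_sub, Finset.sum_sub_distrib]
    rw [htb k, sub_eq_zero]
    simp only [← hst, ← Finset.sum_sub_distrib, Finset.mul_sum]
    rw [Finset.sum_comm]
    exact Finset.sum_congr rfl fun i _ => Finset.sum_congr rfl fun l _ => by ring
  · refine (hc i k).sub (IsHomogeneous.sum _ _ _ fun l _ => ?_)
    have := (isHomogeneous_X K l).mul ((hs k l i).sub (hs l k i))
    rwa [show 1 + (e - d i) = e + 1 - d i by have := hde i; omega] at this
  · funext i
    simp only [Finset.sum_apply, Pi.smul_apply, smul_eq_mul, mul_sub (X _) (c _ _),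
      Finset.sum_sub_distrib]
    rw [hca, sum_mul_sum_antisymm_eq_zero X fun k l => s k l i, sub_zero]

/-- Each degree beyond `τ + 1` splits off one more variable by `exists_syzygies_sum_X_mul`. -/
theorem mem_idealOfVars_pow_smul_syzygies (hf : ∀ i, (f i).IsHomogeneous (d i))
    (hd : ∀ i, d i ≤ τ)
    (hI : ∀ p : MvPolynomial σ K, p.IsHomogeneous τ → p ∈ Ideal.span (Set.range f)) (j : ℕ) :
    ∀ a ∈ syzygies f, (∀ i, (a i).IsHomogeneous (τ + j + 1 - d i)) →
      a ∈ idealOfVars σ K ^ j • syzygies f := by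
  induction j with
  | zero => intro a ha _; simpa using ha
  | succ j ih =>
    intro a ha hah
    obtain ⟨a', ha', hah', rfl⟩ := exists_syzygies_sum_X_mul hf hd hI (e := τ + j)
      (Nat.le_add_right _ _) ha hah
    refine sum_mem fun k _ => ?_
    rw [pow_succ', Submodule.mul_smul]
    exact Submodule.smul_mem_smul (Ideal.subset_span ⟨k, rfl⟩) (ih _ (ha' k) (hah' k))

theorem mem_koszulBoundary_of_isHomogeneous (hf : ∀ i, (f i).IsHomogeneous (d i))
    (hd : ∀ i, d i ≤ τ)
    (hI : ∀ p : MvPolynomial σ K, p.IsHomogeneous τ → p ∈ Ideal.span (Set.range f))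
    {e : ℕ} (he : 2 * τ < e) {a : ι → MvPolynomial σ K} (ha : a ∈ syzygies f)
    (hah : ∀ i, (a i).IsHomogeneous (e - d i)) : a ∈ koszulBoundary f := by
  obtain ⟨j, rfl⟩ := Nat.exists_eq_add_of_lt he
  -- The degree is `2τ + j + 1 = τ + (τ + j) + 1`, so the power `τ + j` is available, and it already
  -- lies in the ideal of the `f i`.
  have h := mem_idealOfVars_pow_smul_syzygies hf hd hI (τ + j) a ha
    (by rwa [← add_assoc, ← two_mul])
  have hle : idealOfVars σ K ^ (τ + j) ≤ Ideal.span (Set.range f) :=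
    (Ideal.pow_le_pow_right (Nat.le_add_right _ _)).trans (idealOfVars_pow_le hI)
  exact span_smul_syzygies_le_koszulBoundary f (Submodule.smul_mono_left hle h)

end Syzygies

/-! ### Evaluation at the generators respects the grading -/

section Aeval

variable {K : Type*} [Field K] {σ ι : Type*} {f : ι → MvPolynomial σ K} {d : ι → ℕ}

theorem isHomogeneous_aeval (hf : ∀ i, (f i).IsHomogeneous (d i)) {p : MvPolynomial ι K} {n : ℕ}
    (hp : IsWeightedHomogeneous d p n) : (aeval f p).IsHomogeneous n := by
  induction hp using IsWeightedHomogeneous.induction_on with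
  | zero => rw [map_zero]; exact isHomogeneous_zero _ _ _
  | add p q _ _ hp hq => rw [map_add]; exact hp.add hq
  | monomial u r hu =>
    rw [aeval_monomial, algebraMap_eq, Finsupp.prod]
    refine IsHomogeneous.C_mul ?_ r
    have h := IsHomogeneous.prod u.support (fun i => f i ^ u i) (fun i => d i * u i)
      fun i _ => (hf i).pow (u i)
    rwa [show ∑ i ∈ u.support, d i * u i = n by
      rw [← hu, Finsupp.weight_apply, Finsupp.sum]
      exact Finset.sum_congr rfl fun i _ => mul_comm _ _] at h

theorem homogeneousComponent_aeval (hf : ∀ i, (f i).IsHomogeneous (d i)) (p : MvPolynomial ι K)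
    (n : ℕ) :
    homogeneousComponent n (aeval f p) = aeval f (weightedHomogeneousComponent d n p) := by
  induction p using MvPolynomial.induction_on' with
  | add p q hp hq => simp only [map_add, hp, hq]
  | monomial u r =>
    have hm := isWeightedHomogeneous_monomial d u r rfl
    have ha := isHomogeneous_aeval hf hm
    by_cases h : Finsupp.weight d u = n
    · subst h
      rw [hm.weightedHomogeneousComponent_same]
      exact IsWeightedHomogeneous.weightedHomogeneousComponent_same ha
    · rw [hm.weightedHomogeneousComponent_ne _ (Ne.symm h), map_zero]
      exact IsWeightedHomogeneous.weightedHomogeneousComponent_ne _ ha (Ne.symm h)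

theorem aeval_mem_adjoin_of_isWeightedHomogeneous {p : MvPolynomial ι K} {n : ℕ}
    (hp : IsWeightedHomogeneous d p n) :
    aeval f p ∈ Algebra.adjoin K (f '' {i | d i ≤ n}) := by
  induction hp using IsWeightedHomogeneous.induction_on with
  | zero => rw [map_zero]; exact zero_mem _
  | add p q _ _ hp hq => rw [map_add]; exact add_mem hp hq
  | monomial u r hu =>
    rw [aeval_monomial, Finsupp.prod]
    refine mul_mem (Subalgebra.algebraMap_mem _ r) (prod_mem fun i hi => pow_mem ?_ _)
    refine Algebra.subset_adjoin ⟨i, ?_, rfl⟩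
    exact hu ▸ Finsupp.le_weight_of_ne_zero' d (Finsupp.mem_support_iff.1 hi)

theorem mem_adjoin_of_isHomogeneous (hf : ∀ i, (f i).IsHomogeneous (d i)) {p : MvPolynomial σ K}
    (hp : p ∈ Algebra.adjoin K (Set.range f)) {n : ℕ} (hn : p.IsHomogeneous n) :
    p ∈ Algebra.adjoin K (f '' {i | d i ≤ n}) := by
  rw [Algebra.adjoin_range_eq_range_aeval] at hp
  obtain ⟨q, rfl⟩ := hp
  have h : homogeneousComponent n (aeval f q) = aeval f q :=
    IsWeightedHomogeneous.weightedHomogeneousComponent_same hn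
  have h' := aeval_mem_adjoin_of_isWeightedHomogeneous (f := f)
    (weightedHomogeneousComponent_isWeightedHomogeneous (w := d) n q)
  rwa [← homogeneousComponent_aeval hf, h] at h'

end Aeval

end InvariantSyzygies

namespace InvariantSyzygies

open MvPolynomial

/-! ### Minimal generators and their relations -/

variable {K : Type*} [Field K] {σ ι : Type*}

theorem notMem_adjoin_of_minimal {A : Type*} [CommRing A] [Algebra K A] {f : ι → A}
    (hmin : ∀ s : Set ι, Algebra.adjoin K (f '' s) = Algebra.adjoin K (Set.range f) →
      s = Set.univ) (i : ι) : f i ∉ Algebra.adjoin K (f '' {i}ᶜ) := by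
  intro h
  have huniv := hmin {i}ᶜ (le_antisymm (Algebra.adjoin_mono (Set.image_subset_range _ _))
    (Algebra.adjoin_le (by
      rintro _ ⟨j, rfl⟩
      by_cases hj : j = i
      · exact hj ▸ h
      · exact Algebra.subset_adjoin ⟨j, hj, rfl⟩)))
  exact (huniv ▸ Set.mem_univ i : i ∈ ({i}ᶜ : Set ι)) rfl

/-- A generator of degree `0` would be a scalar, hence redundant. -/
theorem degree_pos_of_minimal {f : ι → MvPolynomial σ K} {d : ι → ℕ}
    (hf : ∀ i, (f i).IsHomogeneous (d i))
    (hmin : ∀ s : Set ι, Algebra.adjoin K (f '' s) = Algebra.adjoin K (Set.range f) →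
      s = Set.univ) (i : ι) : 0 < d i := by
  refine Nat.pos_of_ne_zero fun h => notMem_adjoin_of_minimal hmin i ?_
  have h0 : homogeneousComponent 0 (f i) = f i :=
    IsWeightedHomogeneous.weightedHomogeneousComponent_same (h ▸ hf i)
  rw [← h0, homogeneousComponent_zero]
  exact Subalgebra.algebraMap_mem _ _

theorem mem_span_range_of_mem_adjoin {f : ι → MvPolynomial σ K} {d : ι → ℕ}
    (hf : ∀ i, (f i).IsHomogeneous (d i)) {p : MvPolynomial σ K}
    (hp : p ∈ Algebra.adjoin K (Set.range f)) {n : ℕ} (hpn : p.IsHomogeneous n) (hn : 0 < n) :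
    p ∈ Ideal.span (Set.range f) := by
  rw [Algebra.adjoin_range_eq_range_aeval] at hp
  obtain ⟨q, rfl⟩ := hp
  have hle : Ideal.span (Set.range X) ≤
      Ideal.comap (aeval f : MvPolynomial ι K →ₐ[K] _) (Ideal.span (Set.range f)) := by
    rw [Ideal.span_le]
    rintro _ ⟨i, rfl⟩
    rw [SetLike.mem_coe, Ideal.mem_comap, aeval_X]
    exact Ideal.subset_span ⟨i, rfl⟩
  have hq := hle (mem_span_range_X (constantCoeff_eq_zero
    (weightedHomogeneousComponent_isWeightedHomogeneous (w := d) n q) hn))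
  rw [Ideal.mem_comap, ← homogeneousComponent_aeval hf] at hq
  rwa [show homogeneousComponent n (aeval f q) = aeval f q from
    IsWeightedHomogeneous.weightedHomogeneousComponent_same hpn] at hq

section Reynolds

variable [Fintype σ] [Fintype ι] {τ : ℕ} {f : ι → MvPolynomial σ K} {d : ι → ℕ}
  {E : MvPolynomial σ K →ₗ[K] MvPolynomial σ K}

/-- Forms of degree `τ` use only generators of degree at most `τ`, and so do all forms of higher
degree. If `d i > τ`, applying `E` to such an expression of `f i` gives invariant coefficients of
degree below `d i`, so `f i` is a polynomial in the other generators. -/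
theorem degree_le_of_minimal (hf : ∀ i, (f i).IsHomogeneous (d i))
    (hmin : ∀ s : Set ι, Algebra.adjoin K (f '' s) = Algebra.adjoin K (Set.range f) →
      s = Set.univ)
    (hI : ∀ p : MvPolynomial σ K, p.IsHomogeneous τ → p ∈ Ideal.span (Set.range f))
    (hE : ∀ p, E p ∈ Algebra.adjoin K (Set.range f))
    (hE1 : ∀ p ∈ Algebra.adjoin K (Set.range f), E p = p)
    (hEmul : ∀ p ∈ Algebra.adjoin K (Set.range f), ∀ q, E (p * q) = p * E q)
    (hEh : ∀ p n, p.IsHomogeneous n → (E p).IsHomogeneous n) (i : ι) : d i ≤ τ := by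
  classical
  by_contra! hi
  have hfR : ∀ j, f j ∈ Algebra.adjoin K (Set.range f) := fun j =>
    Algebra.subset_adjoin ⟨j, rfl⟩
  let g : {j // d j ≤ τ} → MvPolynomial σ K := fun j => f j
  have hg : ∀ p : MvPolynomial σ K, p.IsHomogeneous τ → p ∈ Ideal.span (Set.range g) := by
    intro p hp
    obtain ⟨c, -, hc0, rfl⟩ := exists_homogeneous_coeffs hf hp (hI p hp)
    refine sum_mem fun j _ => ?_
    by_cases hj : d j ≤ τ
    · exact Ideal.mul_mem_right _ _ (Ideal.subset_span ⟨⟨j, hj⟩, rfl⟩)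
    · rw [hc0 j (not_le.1 hj), mul_zero]
      exact zero_mem _
  obtain ⟨c, hc, -, hsum⟩ := exists_homogeneous_coeffs (g := g) (δ := fun j => d j)
    (fun j => hf j) (hf i) (mem_of_isHomogeneous_of_le hg hi.le _ (hf i))
  refine notMem_adjoin_of_minimal hmin i ?_
  have hsub : ∀ n < d i, Algebra.adjoin K (f '' {k | d k ≤ n}) ≤ Algebra.adjoin K (f '' {i}ᶜ) :=
    fun n hn => Algebra.adjoin_mono (Set.image_mono fun k hk hki => by
      rw [Set.mem_singleton_iff.1 hki] at hk
      exact (lt_of_lt_of_le hn hk).false)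
  rw [← hE1 _ (hfR i), ← hsum, map_sum]
  refine sum_mem fun j _ => ?_
  rw [hEmul _ (hfR j)]
  have hj := degree_pos_of_minimal hf hmin j
  refine mul_mem (Algebra.subset_adjoin ⟨j, fun h => ?_, rfl⟩)
    (hsub (d i - d j) (by omega) (mem_adjoin_of_isHomogeneous hf (hE _) (hEh _ _ (hc j))))
  have hji : d j = d i := congrArg d h
  have := j.2
  omega

/-- A homogeneous relation of degree larger than `2 * τ` is a combination, with the variables as
coefficients, of homogeneous relations of smaller degree. -/
theorem exists_relations_sum_X_mul (hf : ∀ i, (f i).IsHomogeneous (d i)) (hd : ∀ i, d i ≤ τ)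
    (hI : ∀ p : MvPolynomial σ K, p.IsHomogeneous τ → p ∈ Ideal.span (Set.range f))
    (hE : ∀ p, E p ∈ Algebra.adjoin K (Set.range f))
    (hE1 : ∀ p ∈ Algebra.adjoin K (Set.range f), E p = p)
    (hEmul : ∀ p ∈ Algebra.adjoin K (Set.range f), ∀ q, E (p * q) = p * E q)
    {e : ℕ} (he : 2 * τ < e) {h : MvPolynomial ι K} (hh : IsWeightedHomogeneous d h e)
    (h0 : aeval f h = 0) :
    ∃ q : ι → MvPolynomial ι K, (∀ i, IsWeightedHomogeneous d (q i) (e - d i)) ∧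
      (∀ i, aeval f (q i) = 0) ∧ ∑ i, X i * q i = h := by
  obtain ⟨c, hc, -, hsum⟩ := exists_homogeneous_coeffs (g := (X : ι → MvPolynomial ι K)) (δ := d)
    (fun i => isWeightedHomogeneous_X K d i) hh
    (mem_span_range_X (constantCoeff_eq_zero hh (by omega)))
  have hsyz : (fun i => aeval f (c i)) ∈ syzygies f := by
    rw [mem_syzygies, ← h0, ← hsum, map_sum]
    exact Finset.sum_congr rfl fun i _ => by rw [map_mul, aeval_X]
  obtain ⟨u, hu⟩ := mem_koszulBoundary_of_isHomogeneous hf hd hI he hsyz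
    fun i => isHomogeneous_aeval hf (hc i)
  have hlift : ∀ p ∈ Algebra.adjoin K (Set.range f), ∃ q : MvPolynomial ι K, aeval f q = p := by
    intro p hp
    rwa [Algebra.adjoin_range_eq_range_aeval] at hp
  choose v hv using fun i j => hlift _ (hE (u i j))
  -- Applying `E` to the Koszul expression of `aeval f (c i)` shows that `b i` is a relation. It
  -- need not be homogeneous, so the component of degree `e - d i` is taken at the end.
  let b : ι → MvPolynomial ι K := fun i => c i - ∑ j, X j * (v i j - v j i)
  have hb0 : ∀ i, aeval f (b i) = 0 := fun i => by
    have hci : aeval f (c i) = ∑ j, f j * (E (u i j) - E (u j i)) := by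
      have hR : aeval f (c i) ∈ Algebra.adjoin K (Set.range f) := by
        rw [Algebra.adjoin_range_eq_range_aeval]
        exact ⟨c i, rfl⟩
      rw [← hE1 _ hR, show aeval f (c i) = _ from hu i, map_sum]
      exact Finset.sum_congr rfl fun j _ => by
        rw [hEmul _ (Algebra.subset_adjoin ⟨j, rfl⟩), map_sub]
    simp only [b, map_sub, map_sum, map_mul, aeval_X, hv]
    rw [hci, sub_self]
  have hbsum : ∑ i, X i * b i = h := by
    simp only [b, mul_sub (X _) (c _), Finset.sum_sub_distrib]
    rw [hsum, sum_mul_sum_antisymm_eq_zero X v, sub_zero]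
  refine ⟨fun i => weightedHomogeneousComponent d (e - d i) (b i),
    fun i => weightedHomogeneousComponent_isWeightedHomogeneous _ _, fun i => ?_, ?_⟩
  · rw [← homogeneousComponent_aeval hf, hb0, map_zero]
  · rw [← hh.weightedHomogeneousComponent_same, ← hbsum, map_sum]
    refine Finset.sum_congr rfl fun i _ => ?_
    have := hd i
    rw [weightedHomogeneousComponent_mul_of_le (isWeightedHomogeneous_X K d i) _ (by omega)]

end Reynolds

theorem generatedInDegreeLE_ker_aeval [Fintype σ] {r τ : ℕ} {f : Fin r → MvPolynomial σ K}
    {d : Fin r → ℕ} (hf : ∀ i, (f i).IsHomogeneous (d i))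
    (hmin : ∀ s : Set (Fin r), Algebra.adjoin K (f '' s) = Algebra.adjoin K (Set.range f) →
      s = Set.univ)
    (hI : ∀ p : MvPolynomial σ K, p.IsHomogeneous τ → p ∈ Ideal.span (Set.range f))
    {E : MvPolynomial σ K →ₗ[K] MvPolynomial σ K}
    (hE : ∀ p, E p ∈ Algebra.adjoin K (Set.range f))
    (hE1 : ∀ p ∈ Algebra.adjoin K (Set.range f), E p = p)
    (hEmul : ∀ p ∈ Algebra.adjoin K (Set.range f), ∀ q, E (p * q) = p * E q)
    (hEh : ∀ p n, p.IsHomogeneous n → (E p).IsHomogeneous n) :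
    GeneratedInDegreeLE d (RingHom.ker (aeval f : MvPolynomial (Fin r) K →ₐ[K] _)) (2 * τ) := by
  have hpos := degree_pos_of_minimal hf hmin
  have hle := degree_le_of_minimal hf hmin hI hE hE1 hEmul hEh
  unfold GeneratedInDegreeLE
  refine le_antisymm (Ideal.span_le.2 fun h hh => hh.1) fun h hh => ?_
  have key : ∀ e : ℕ, ∀ h : MvPolynomial (Fin r) K, IsWeightedHomogeneous d h e →
      aeval f h = 0 → h ∈ Ideal.span {h | h ∈ RingHom.ker (aeval f : MvPolynomial (Fin r) K →ₐ[K]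
        MvPolynomial σ K) ∧ ∃ e : ℕ, e ≤ 2 * τ ∧ IsWeightedHomogeneous d h e} := by
    intro e
    induction e using Nat.strong_induction_on with
    | _ e ih =>
      intro h hh h0
      by_cases he : e ≤ 2 * τ
      · exact Ideal.subset_span ⟨h0, e, he, hh⟩
      · obtain ⟨q, hq, hq0, rfl⟩ :=
          exists_relations_sum_X_mul hf hle hI hE hE1 hEmul (not_le.1 he) hh h0
        refine sum_mem fun i _ => Ideal.mul_mem_left _ _ (ih (e - d i) ?_ _ (hq i) (hq0 i))
        have := hpos i
        omega
  have h0 : aeval f h = 0 := hh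
  rw [← sum_weightedHomogeneousComponent d h,
    finsum_eq_sum _ (weightedHomogeneousComponent_finsupp h)]
  refine sum_mem fun e _ => key e _ (weightedHomogeneousComponent_isWeightedHomogeneous _ _) ?_
  rw [← homogeneousComponent_aeval hf, h0, map_zero]

end InvariantSyzygies

namespace InvariantSyzygies

/-! ### Group action, Benson's lemma and the Reynolds operator -/

section Action

variable {K : Type*} [Field K] {V : Type*} [AddCommGroup V] [Module K V] {G : Type*} [Group G]
  (ρ : Representation K G V)

theorem act_mul (g h : G) (p : CoordRing K V) : act ρ (g * h) p = act ρ g (act ρ h p) := by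
  have : act ρ (g * h) = (act ρ g).comp (act ρ h) := by
    refine SymmetricAlgebra.algHom_ext (LinearMap.ext fun l => ?_)
    simp [act, map_mul]
  rw [this, AlgHom.comp_apply]

theorem mem_invariantRing {p : CoordRing K V} : p ∈ invariantRing ρ ↔ ∀ g, act ρ g p = p := by
  simp [invariantRing, Algebra.mem_iInf, AlgHom.mem_equalizer]

theorem act_mem_homogeneousPart (g : G) {p : CoordRing K V} {n : ℕ}
    (hp : p ∈ homogeneousPart K V n) : act ρ g p ∈ homogeneousPart K V n := by
  have h := Submodule.mem_map_of_mem (f := (act ρ g).toLinearMap) hp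
  rw [homogeneousPart, Submodule.map_pow] at h
  have hle : (LinearMap.range (SymmetricAlgebra.ι K (Module.Dual K V))).map
      (act ρ g).toLinearMap ≤ LinearMap.range (SymmetricAlgebra.ι K (Module.Dual K V)) := by
    rintro _ ⟨_, ⟨l, rfl⟩, rfl⟩
    exact ⟨ρ.dual g l, by simp [act]⟩
  exact pow_le_pow_left' hle n h

theorem prod_mem_homogeneousPart {ι : Type*} (s : Finset ι) (v : ι → CoordRing K V)
    (hv : ∀ i ∈ s, v i ∈ homogeneousPart K V 1) :
    ∏ i ∈ s, v i ∈ homogeneousPart K V s.card := by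
  classical
  induction s using Finset.induction_on with
  | empty => simp [homogeneousPart]
  | insert i s hi ih =>
    rw [Finset.prod_insert hi, Finset.card_insert_of_notMem hi, homogeneousPart, pow_succ']
    refine Submodule.mul_mem_mul ?_ (ih fun j hj => hv j (Finset.mem_insert_of_mem hj))
    simpa [homogeneousPart] using hv i (Finset.mem_insert_self i s)

variable [Fintype G]

theorem sum_act_mul_mem_invariantRing (t : Finset G) (v : G → CoordRing K V) :
    ∑ h, ∏ g ∈ t, act ρ (h * g) (v g) ∈ invariantRing ρ := by
  rw [mem_invariantRing]
  intro k
  simp only [map_sum, map_prod, ← act_mul, ← mul_assoc]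
  exact Fintype.sum_equiv (Equiv.mulLeft k) _ _ fun h => rfl

/-- Benson's lemma: a product of linear forms indexed by `G` lies in the Hilbert ideal. -/
theorem prod_mem_hilbertIdeal (hG : (Fintype.card G : K) ≠ 0) (v : G → CoordRing K V)
    (hv : ∀ g, v g ∈ homogeneousPart K V 1) : ∏ g, v g ∈ hilbertIdeal ρ := by
  classical
  -- The factor at `g = h⁻¹` vanishes.
  have hzero : ∀ h : G, ∏ g, (v g - act ρ (h * g) (v g)) = 0 := fun h => by
    refine Finset.prod_eq_zero (Finset.mem_univ h⁻¹) ?_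
    have h1 : act ρ (1 : G) = AlgHom.id K _ := by
      refine SymmetricAlgebra.algHom_ext (LinearMap.ext fun l => ?_)
      simp only [act, map_one]
      simp
    rw [mul_inv_cancel, h1, AlgHom.id_apply, sub_self]
  have hsum : ∑ h : G, ∏ g, (v g - act ρ (h * g) (v g)) = 0 :=
    Finset.sum_eq_zero fun h _ => hzero h
  simp only [Finset.prod_sub] at hsum
  rw [Finset.sum_comm] at hsum
  simp only [← Finset.mul_sum] at hsum
  -- In the expansion over subsets `t` of `G`, the empty set contributes `|G| * ∏ v g`. Every other
  -- term is a multiple of an invariant of degree `t.card > 0`.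
  rw [← Finset.add_sum_erase _ _ (Finset.empty_mem_powerset _)] at hsum
  simp only [Finset.card_empty, pow_zero, Finset.sdiff_empty, one_mul, Finset.prod_empty,
    Finset.sum_const, Finset.card_univ, nsmul_eq_mul, mul_one] at hsum
  have hmem : (∏ g, v g) * (Fintype.card G : CoordRing K V) ∈ hilbertIdeal ρ := by
    rw [eq_neg_of_add_eq_zero_left hsum]
    refine neg_mem (sum_mem fun t ht => Ideal.mul_mem_left _ _ (Ideal.subset_span
      ⟨sum_act_mul_mem_invariantRing ρ t v, t.card, ?_, sum_mem fun h _ =>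
        prod_mem_homogeneousPart t _ fun g _ => act_mem_homogeneousPart ρ _ (hv g)⟩))
    exact Finset.card_pos.2 (Finset.nonempty_iff_ne_empty.2 (Finset.ne_of_mem_erase ht))
  have hinv := Ideal.mul_mem_right (algebraMap K _ (Fintype.card G : K)⁻¹) _ hmem
  rwa [mul_assoc, ← map_natCast (algebraMap K (CoordRing K V)), ← map_mul, mul_inv_cancel₀ hG,
    map_one, mul_one] at hinv

theorem card_mem_hilbertDegrees (hG : (Fintype.card G : K) ≠ 0) :
    Fintype.card G ∈ hilbertDegrees ρ := by
  intro p hp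
  rw [homogeneousPart, Submodule.pow_eq_span_pow_set] at hp
  refine (Submodule.span_le (p := (hilbertIdeal ρ).restrictScalars K)).2 ?_ hp
  intro q hq
  obtain ⟨u, rfl⟩ := Set.mem_pow.1 hq
  rw [List.prod_ofFn, ← (Fintype.equivFin G).prod_comp]
  refine prod_mem_hilbertIdeal ρ hG _ fun g => ?_
  rw [homogeneousPart, pow_one]
  exact (u _).2

/-- The Reynolds operator, averaging over the group. -/
def reynolds : CoordRing K V →ₗ[K] CoordRing K V :=
  (Fintype.card G : K)⁻¹ • ∑ g : G, (act ρ g).toLinearMap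

theorem reynolds_apply (p : CoordRing K V) :
    reynolds ρ p = (Fintype.card G : K)⁻¹ • ∑ g : G, act ρ g p := by
  simp [reynolds]

theorem reynolds_mem (p : CoordRing K V) : reynolds ρ p ∈ invariantRing ρ := by
  rw [reynolds_apply, mem_invariantRing]
  intro k
  rw [map_smul, map_sum]
  congr 1
  simp only [← act_mul]
  exact Fintype.sum_equiv (Equiv.mulLeft k) _ _ fun h => rfl

theorem reynolds_mul {p : CoordRing K V} (hp : p ∈ invariantRing ρ) (q : CoordRing K V) :
    reynolds ρ (p * q) = p * reynolds ρ q := by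
  simp only [reynolds_apply, map_mul, (mem_invariantRing ρ).1 hp, ← Finset.mul_sum,
    mul_smul_comm]

theorem reynolds_eq_self (hG : (Fintype.card G : K) ≠ 0) {p : CoordRing K V}
    (hp : p ∈ invariantRing ρ) : reynolds ρ p = p := by
  simp only [reynolds_apply, (mem_invariantRing ρ).1 hp, Finset.sum_const, Finset.card_univ]
  rw [← Nat.cast_smul_eq_nsmul K, smul_smul, inv_mul_cancel₀ hG, one_smul]

theorem reynolds_mem_homogeneousPart {p : CoordRing K V} {n : ℕ}
    (hp : p ∈ homogeneousPart K V n) : reynolds ρ p ∈ homogeneousPart K V n := by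
  rw [reynolds_apply]
  exact Submodule.smul_mem _ _ (sum_mem fun g _ => act_mem_homogeneousPart ρ g hp)

end Action

/-- A basis of the dual turns the intrinsic grading into the standard one, so the results on
`MvPolynomial` apply. -/
theorem map_homogeneousPart {K : Type*} [Field K] {V : Type*} [AddCommGroup V] [Module K V]
    {σ : Type*} (b : Module.Basis σ K (Module.Dual K V)) (n : ℕ) :
    (homogeneousPart K V n).map (SymmetricAlgebra.equivMvPolynomial b).toAlgHom.toLinearMap =
      MvPolynomial.homogeneousSubmodule σ K n := by
  rw [homogeneousPart, Submodule.map_pow, ← MvPolynomial.homogeneousSubmodule_one_pow,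
    LinearMap.range_eq_map, ← b.span_eq, Submodule.map_span, Submodule.map_span,
    MvPolynomial.homogeneousSubmodule_one_eq_span_X, ← Set.range_comp, ← Set.range_comp]
  congr 3
  funext i
  simp

end InvariantSyzygies

theorem theorem2 {K : Type*} [Field K] {G : Type*} [Group G] [Finite G]
    {V : Type*} [AddCommGroup V] [Module K V] [Module.Finite K V]
    (ρ : Representation K G V) (hG : ¬ ringChar K ∣ Nat.card G)
    {r : ℕ} (f : Fin r → InvariantSyzygies.CoordRing K V) (d : Fin r → ℕ)
    (hd : ∀ i, f i ∈ InvariantSyzygies.homogeneousPart K V (d i))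
    (hf : InvariantSyzygies.IsMinimalGenerators ρ f) :
    IsLeast (InvariantSyzygies.hilbertDegrees ρ) (InvariantSyzygies.tau ρ) ∧
      InvariantSyzygies.GeneratedInDegreeLE d (InvariantSyzygies.relationIdeal f)
        (2 * InvariantSyzygies.tau ρ) ∧
      2 * InvariantSyzygies.tau ρ ≤ 2 * Nat.card G := by
  open InvariantSyzygies in
  have := Fintype.ofFinite G
  rw [Nat.card_eq_fintype_card] at hG ⊢
  have hG' : (Fintype.card G : K) ≠ 0 := fun h => hG (ringChar.dvd h)
  have hcard := card_mem_hilbertDegrees ρ hG'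
  -- The infimum is attained because `|G|` belongs to the set; on the empty set `sInf` would be `0`
  -- by default.
  have htau : tau ρ ∈ hilbertDegrees ρ := Nat.sInf_mem ⟨_, hcard⟩
  refine ⟨⟨htau, fun n hn => Nat.sInf_le hn⟩, ?_, Nat.mul_le_mul_left 2 (Nat.sInf_le hcard)⟩
  let b := Module.finBasis K (Module.Dual K V)
  let e := SymmetricAlgebra.equivMvPolynomial b
  have hhom : ∀ p n, p ∈ homogeneousPart K V n ↔ (e p).IsHomogeneous n := fun p n => by
    rw [← MvPolynomial.mem_homogeneousSubmodule, ← map_homogeneousPart b]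
    exact ⟨fun h => Submodule.mem_map_of_mem h, fun ⟨q, hq, h⟩ => e.injective h ▸ hq⟩
  have hadj : ∀ s, Algebra.adjoin K ((fun i => e (f i)) '' s) =
      (Algebra.adjoin K (f '' s)).map e.toAlgHom := fun s => by
    rw [AlgHom.map_adjoin, ← Set.image_comp]
    rfl
  have hrange : Algebra.adjoin K (Set.range fun i => e (f i)) =
      (invariantRing ρ).map e.toAlgHom := by
    rw [← Set.image_univ, hadj, Set.image_univ, hf.1]
  have hmem : ∀ p, p ∈ Algebra.adjoin K (Set.range fun i => e (f i)) ↔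
      e.symm p ∈ invariantRing ρ := fun p => by
    rw [hrange]
    constructor
    · rintro ⟨q, hq, rfl⟩
      exact (e.symm_apply_apply q).symm ▸ hq
    · exact fun h => ⟨_, h, e.apply_symm_apply p⟩
  have hF : ∀ i, (e (f i)).IsHomogeneous (d i) := fun i => (hhom _ _).1 (hd i)
  have hmin : ∀ s : Set (Fin r), Algebra.adjoin K ((fun i => e (f i)) '' s) =
      Algebra.adjoin K (Set.range fun i => e (f i)) → s = Set.univ := fun s hs =>
    hf.2 s (Subalgebra.map_injective (f := e.toAlgHom) e.injective (by rw [← hadj, hs, hrange]))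
  have hI : ∀ p : MvPolynomial _ K, p.IsHomogeneous (tau ρ) →
      p ∈ Ideal.span (Set.range fun i => e (f i)) := by
    have hle : hilbertIdeal ρ ≤ Ideal.comap e (Ideal.span (Set.range fun i => e (f i))) := by
      refine Ideal.span_le.2 ?_
      rintro p ⟨hp, n, hn, hpn⟩
      refine mem_span_range_of_mem_adjoin hF ((hmem _).2 ?_) ((hhom _ _).1 hpn) hn
      rwa [e.symm_apply_apply]
    intro p hp
    have := hle (htau (e.symm p) ((hhom _ _).2 (by rwa [e.apply_symm_apply])))
    rwa [Ideal.mem_comap, e.apply_symm_apply] at this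
  have hker : relationIdeal f =
      RingHom.ker (MvPolynomial.aeval fun i => e (f i) : MvPolynomial (Fin r) K →ₐ[K] _) := by
    ext h
    have : MvPolynomial.aeval (fun i => e (f i)) h = e (MvPolynomial.aeval f h) :=
      (MvPolynomial.comp_aeval_apply f e.toAlgHom h).symm
    rw [relationIdeal, RingHom.mem_ker, RingHom.mem_ker, this, map_eq_zero_iff e e.injective]
  rw [hker]
  refine generatedInDegreeLE_ker_aeval (E := e.toLinearMap ∘ₗ reynolds ρ ∘ₗ e.symm.toLinearMap)
    hF hmin hI (fun p => ?_) (fun p hp => ?_) (fun p hp q => ?_) fun p n hp => ?_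
  · rw [hmem]
    simpa using reynolds_mem ρ (e.symm p)
  · simp [reynolds_eq_self ρ hG' ((hmem p).1 hp)]
  · simp [reynolds_mul ρ ((hmem p).1 hp)]
  · exact (hhom _ _).1 (reynolds_mem_homogeneousPart ρ
      ((hhom _ _).2 (by simpa using hp)))
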